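/- Fix $p\in(0,1]$, $\beta>8$ and an integer $L\ge 1$. For each $n$ consider $n$ nodes, each holding one packet, a vector in $\mathbb{F}_2^L$. The communication graph is a directed Erdős–Rényi graph $G(n,p)$ on the nodes (each ordered pair of distinct nodes is an edge with probability $p$, independently of all other pairs; no loops), and it is the same in all rounds $t=1,2,\dots$: whatever $u$ broadcasts in any round is received by exactly those $v$ for which $(u,v)$ is an edge. Let $N^{\rm in}_v$ be the set of in-neighbours of $v$ and $d^{\rm in}_v=|N^{\rm in}_v|$. Under Algorithm RLNC($\beta$), every node broadcasts its own packet in round 1. In each round $t\ge 2$, node $v$ broadcasts the linear combination $\sum_w X_{vw}(t)P_w$ of the packets $P_w$, together with the coefficients $X_{vw}(t)\in\mathbb{F}_2$. Given the graph, the $X_{vw}(t)$ are mutually independent, with $\mathbb{P}(X_{vw}(t)=1)=\min\{1,\beta\log (d^{\rm in}_v)/d^{\rm in}_v\}$ if $w\in N^{\rm in}_v$, and $X_{vw}(t)=0$ otherwise. A node $v$ is able to decode all packets at the end of round $T$ if the values of all $n$ packets are uniquely determined by its own packet and the broadcasts (with their coefficients) that it received in rounds $1,\dots,T$. Let $T^{\rm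 all}_n(RLNC(\beta))\in\{0,1,2,\dots\}\cup\{\infty\}$ be the smallest number of rounds after which all nodes are able to decode all packets. Then $$\lim_{n\to\infty}\mathbb{P}\Bigl(T^{\rm all}_n(RLNC(\beta))>\Bigl\lceil\frac1p\Bigr\rceil+2\Bigr)=0,$$ where the probability is over both the graph and the coefficients. -/

import Mathlib

open MeasureTheory ProbabilityTheory Filter Topology

namespace RLNC

/-- A directed communication graph on the nodes `Fin n`, given by its set of edges;
`(u, v)` is an edge when the broadcasts of `u` are received by `v`.
The graph is the same in all rounds. -/
abbrev Graph (n : ℕ) : Type := Set (Fin n × Fin n)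

/-- The coefficients: `X (t, v, w)` is the coefficient that node `v` gives to the packet of
node `w` in round `t`. Only the rounds `t ≥ 2` are used by the algorithm. -/
abbrev Coeffs (n : ℕ) : Type := ℕ × Fin n × Fin n → ZMod 2

/-- The in-neighbours of `v`, that is, the nodes whose packet `v` receives in round 1. -/
def inNbrs {n : ℕ} (E : Graph n) (v : Fin n) : Set (Fin n) := {u | (u, v) ∈ E}

/-- The in-degree of `v`. -/
noncomputable def inDeg {n : ℕ} (E : Graph n) (v : Fin n) : ℕ := (inNbrs E v).ncard

/-- The law of the directed Erdős–Rényi graph `G(n, p)`: every ordered pair of distinct nodes is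
an edge with probability `p`, independently of all other pairs; there are no loops. -/
noncomputable def graphLaw (n : ℕ) (p : unitInterval) : Measure (Graph n) :=
  setBernoulli {e : Fin n × Fin n | e.1 ≠ e.2} p

/-- The probability `β log d / d`, truncated to `[0, 1]`, used by a node of in-degree `d`. -/
noncomputable def coeffProb (β : ℝ) (d : ℕ) : unitInterval :=
  Set.projIcc 0 1 zero_le_one (β * Real.log d / d)

open scoped Classical in
/-- The law of a single coefficient, in the communication graph `E`: it is Bernoulli if `w` is an
in-neighbour of `v`, and is equal to zero otherwise. -/
noncomputable def entryLaw {n : ℕ} (β : ℝ) (E : Graph n) (i : ℕ × Fin n × Fin n) :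
    Measure (ZMod 2) :=
  bernoulliMeasure 1 0 (if i.2.2 ∈ inNbrs E i.2.1 then coeffProb β (inDeg E i.2.1) else 0)

instance {n : ℕ} (β : ℝ) (E : Graph n) (i : ℕ × Fin n × Fin n) :
    IsProbabilityMeasure (entryLaw β E i) := by
  unfold entryLaw; infer_instance

/-- The conditional law of all coefficients given the communication graph: they are mutually
independent. -/
noncomputable def coeffKernel (n : ℕ) (β : ℝ) : Kernel (Graph n) (Coeffs n) where
  toFun E := Measure.infinitePi (entryLaw β E)
  measurable' := measurable_of_countable _

instance (n : ℕ) (β : ℝ) : IsMarkovKernel (coeffKernel n β) :=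
  ⟨fun E => inferInstanceAs (IsProbabilityMeasure (Measure.infinitePi (entryLaw β E)))⟩

instance (n : ℕ) (p : unitInterval) : IsProbabilityMeasure (graphLaw n p) := by
  unfold graphLaw; infer_instance

/-- The joint law of the random communication graph and of the coefficients. -/
noncomputable def systemLaw (n : ℕ) (p : unitInterval) (β : ℝ) : Measure (Graph n × Coeffs n) :=
  (graphLaw n p).compProd (coeffKernel n β)

instance (n : ℕ) (p : unitInterval) (β : ℝ) : IsProbabilityMeasure (systemLaw n p β) := by
  unfold systemLaw; infer_instance

/-- The content of the broadcast of node `u` in round `t`, where the packet of node `w` is the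
vector `P w` of `L` bits: its own packet in round 1, and the random linear combination in each
subsequent round. -/
def broadcast {n L : ℕ} (X : Coeffs n) (P : Fin n → (Fin L → ZMod 2)) (t : ℕ) (u : Fin n) :
    Fin L → ZMod 2 :=
  if t ≤ 1 then P u else ∑ w, X (t, u, w) • P w

/-- Node `v` can decode all packets at the end of round `T`: its own packet and the
contents of the broadcasts it received in rounds `1, …, T` (whose coefficients it knows)
determine all packets. -/
def CanDecode {n : ℕ} (L : ℕ) (E : Graph n) (X : Coeffs n) (T : ℕ) (v : Fin n) : Prop :=
  ∀ P Q : Fin n → (Fin L → ZMod 2), P v = Q v →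
    (∀ t ∈ Finset.Icc 1 T, ∀ u ∈ inNbrs E v, broadcast X P t u = broadcast X Q t u) → P = Q

/-- The number of rounds until all nodes are able to decode all packets (`⊤` if there is
no such round). -/
noncomputable def allcastTime {n : ℕ} (L : ℕ) (ω : Graph n × Coeffs n) : ℕ∞ :=
  ⨅ (T : ℕ) (_ : ∀ v, CanDecode L ω.1 ω.2 T v), (T : ℕ∞)

end RLNC

/-! If `v` cannot decode, two packet assignments agree with all it knows yet differ; at a bit where
they differ, the difference is the indicator of a nonempty set `S` avoiding `v`, and every
combination received in rounds `2, …, T` is orthogonal to it. So it suffices to union bound over `v`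
and `S`. Given the graph, a row of `u` with coefficient probability `q` and `j` in-neighbours in `S`
is orthogonal to `S` with probability `(1 + (1 - 2q)^j) / 2` (`coeffKernel_orthogonal`). Rows are
independent, so these factors multiply over the in-neighbours `u` of `v` and over `M = ⌈1/p⌉ + 1`
rounds. With high probability the graph is near-regular, and on such graphs three ranges of `S`
occur. If `q|S|` is small, each factor is about `exp(-q j)`, and the sum of `j` counts paths of
length two from `S` to `v`, about `p² n |S|`. As `Mp ≥ 1` and `q ≥ 7 log n / (pn)`, the probability
is at most `n^(-4|S|)`. For larger `S`, a second moment argument gives `j ≥ p|S|/2` for nearly all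
`u`. When `|S|` is linear in `n`, each such factor tends to `1/2`, and there are at least `(1 + p/2)
n` of them since `Mp ≥ 1 + p`: this beats the `2^n` sets, and is where the extra round is spent. In
between, the factors are only bounded by a constant below one, but such sets are few, which a weight
`l^|S|` records. -/

namespace RLNC

/-! ### Independent variables: expectations of products and a Chernoff bound. -/

section Multilinear

variable {Ω ι ρ : Type*} [MeasurableSpace Ω] {μ : Measure Ω} {X : ι → Ω → ℝ}

lemma integral_prod_finset (hX : iIndepFun X μ) (hm : ∀ i, Measurable (X i)) (s : Finset ι) :
    ∫ ω, ∏ i ∈ s, X i ω ∂μ = ∏ i ∈ s, ∫ ω, X i ω ∂μ := by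
  have h := (hX.precomp (g := ((↑) : s → ι)) Subtype.val_injective).integral_fun_prod_eq_prod_integral
    (fun i => (hm i).aestronglyMeasurable)
  simp only [Finset.prod_coe_sort s (fun i => ∫ ω, X i ω ∂μ)] at h
  rw [← h]
  refine integral_congr_ae (ae_of_all _ fun ω => ?_)
  exact (Finset.prod_coe_sort s (fun i => X i ω)).symm

/-- The expectation of a product of affine functions of monomials in independent variables, the
monomials having pairwise disjoint supports. -/
lemma integral_prod_affine_monomials (hX : iIndepFun X μ) (hm : ∀ i, Measurable (X i))
    (hb : ∀ i ω, |X i ω| ≤ 1) (R : Finset ρ) (F : ρ → Finset ι)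
    (hF : (R : Set ρ).PairwiseDisjoint F) (a b : ℝ) :
    ∫ ω, ∏ r ∈ R, (a + b * ∏ i ∈ F r, X i ω) ∂μ
      = ∏ r ∈ R, (a + b * ∏ i ∈ F r, ∫ ω, X i ω ∂μ) := by
  classical
  have := hX.isProbabilityMeasure
  have hprod : ∀ (c : ι → ℝ) (A : Finset ρ), A ⊆ R →
      ∏ r ∈ A, ∏ i ∈ F r, c i = ∏ i ∈ A.biUnion F, c i := fun c A hA =>
    (Finset.prod_biUnion (hF.subset (by exact_mod_cast hA))).symm
  -- Both sides are expanded over subsets of `R`. Disjoint supports make each term a product of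
  -- distinct variables, so its expectation factorizes.
  simp only [Finset.prod_add, Finset.prod_mul_distrib]
  have hint : ∀ s : Finset ι, Integrable (fun ω => ∏ i ∈ s, X i ω) μ := fun s => by
    refine Integrable.of_bound (C := 1)
      (Finset.measurable_fun_prod s fun i _ => hm i).aestronglyMeasurable (ae_of_all _ fun ω => ?_)
    rw [Real.norm_eq_abs, Finset.abs_prod]
    exact Finset.prod_le_one (fun _ _ => abs_nonneg _) (fun i _ => hb i ω)
  have hterm : ∀ A ∈ R.powerset, ∀ c : ι → ℝ,
      (∏ r ∈ A, a) * ((∏ r ∈ R \ A, b) * ∏ r ∈ R \ A, ∏ i ∈ F r, c i)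
        = ((∏ r ∈ A, a) * (∏ r ∈ R \ A, b)) * ∏ i ∈ (R \ A).biUnion F, c i := by
    intro A _ c
    rw [hprod c _ Finset.sdiff_subset, mul_assoc]
  rw [Finset.sum_congr rfl fun A hA => hterm A hA _]
  have : ∀ ω, ∑ A ∈ R.powerset, (∏ r ∈ A, a) * ((∏ r ∈ R \ A, b) * ∏ r ∈ R \ A, ∏ i ∈ F r, X i ω)
      = ∑ A ∈ R.powerset, ((∏ r ∈ A, a) * (∏ r ∈ R \ A, b)) * ∏ i ∈ (R \ A).biUnion F, X i ω :=
    fun ω => Finset.sum_congr rfl fun A hA => hterm A hA _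
  simp_rw [this]
  rw [integral_finsetSum _ fun A _ => (hint _).const_mul _]
  refine Finset.sum_congr rfl fun A _ => ?_
  rw [integral_const_mul, integral_prod_finset hX hm]

lemma exp_sub_one_le {t : ℝ} (ht : |t| ≤ 1) : Real.exp t - 1 ≤ t + t ^ 2 := by
  have h := Real.abs_exp_sub_one_sub_id_le ht
  linarith [le_abs_self (Real.exp t - 1 - t)]

/-- A Chernoff bound for the number of blocks `F r`, among pairwise disjoint blocks of size `k`,
on which all the independent Bernoulli variables `X i` are equal to one. -/
lemma chernoff_blocks (hX : iIndepFun X μ) (hm : ∀ i, Measurable (X i))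
    (h01 : ∀ i ω, X i ω = 0 ∨ X i ω = 1) (R : Finset ρ) (F : ρ → Finset ι)
    (hF : (R : Set ρ).PairwiseDisjoint F) {p : ℝ} (hp0 : 0 ≤ p) (hp1 : p ≤ 1)
    (hp : ∀ r ∈ R, ∀ i ∈ F r, ∫ ω, X i ω ∂μ = p) {k : ℕ} (hk : ∀ r ∈ R, (F r).card = k)
    {δ : ℝ} (hδ0 : 0 ≤ δ) (hδ1 : δ ≤ 1) {s : ℝ} (hs : s ^ 2 = 1) :
    μ.real {ω | δ * R.card ≤ s * (∑ r ∈ R, ∏ i ∈ F r, X i ω - p ^ k * R.card)}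
      ≤ Real.exp (-(δ ^ 2 / 4) * R.card) := by
  have := hX.isProbabilityMeasure
  -- The sign `s = ±1` selects the tail; `δ / 2` minimizes the exponent `-δ|t| + t²`.
  set t : ℝ := s * (δ / 2) with ht
  have ht2 : t ^ 2 = δ ^ 2 / 4 := by rw [ht, mul_pow, hs]; ring
  have htabs : |t| ≤ 1 := by
    rw [← sq_le_one_iff_abs_le_one, ht2]; nlinarith
  -- Block products are 0 or 1, so this is the exponential of `t` times the count, written as a
  -- product of affine functions of monomials.
  set Z : Ω → ℝ := fun ω => ∏ r ∈ R, (1 + (Real.exp t - 1) * ∏ i ∈ F r, X i ω) with hZ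
  have hblock : ∀ r ω, (∏ i ∈ F r, X i ω) = 0 ∨ (∏ i ∈ F r, X i ω) = 1 := by
    intro r ω
    by_cases h : ∃ i ∈ F r, X i ω = 0
    · obtain ⟨i, hi, h0⟩ := h
      exact Or.inl (Finset.prod_eq_zero hi h0)
    · push Not at h
      exact Or.inr (Finset.prod_eq_one fun i hi => (h01 i ω).resolve_left (h i hi))
  have hZexp : ∀ ω, Z ω = Real.exp (t * ∑ r ∈ R, ∏ i ∈ F r, X i ω) := by
    intro ω
    rw [Finset.mul_sum, Real.exp_sum]
    refine Finset.prod_congr rfl fun r _ => ?_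
    rcases hblock r ω with h | h <;> simp [h]
  have hZm : Measurable Z := by
    refine Finset.measurable_fun_prod R fun r _ => ?_
    exact ((Finset.measurable_fun_prod (F r) fun i _ => hm i).const_mul _).const_add _
  have hZint : Integrable Z μ := by
    refine Integrable.of_bound (C := Real.exp (1 * R.card)) hZm.aestronglyMeasurable
      (ae_of_all _ fun ω => ?_)
    rw [hZexp, Real.norm_eq_abs, Real.abs_exp, Real.exp_le_exp]
    have h0 : 0 ≤ ∑ r ∈ R, ∏ i ∈ F r, X i ω := Finset.sum_nonneg fun r _ => by
      rcases hblock r ω with h | h <;> simp [h]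
    have h1 : ∑ r ∈ R, ∏ i ∈ F r, X i ω ≤ R.card := by
      have := Finset.sum_le_card_nsmul R (fun r => ∏ i ∈ F r, X i ω) 1 fun r _ => by
        rcases hblock r ω with h | h <;> simp [h]
      simpa using this
    exact mul_le_mul (le_trans (le_abs_self t) htabs) h1 h0 zero_le_one
  have hEZ : ∫ ω, Z ω ∂μ = (1 + (Real.exp t - 1) * p ^ k) ^ R.card := by
    rw [hZ, integral_prod_affine_monomials hX hm (fun i ω => by
      rcases h01 i ω with h | h <;> simp [h]) R F hF]
    rw [Finset.prod_congr rfl (g := fun _ => 1 + (Real.exp t - 1) * p ^ k), Finset.prod_const]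
    intro r hr
    rw [Finset.prod_congr rfl (hp r hr), Finset.prod_const, hk r hr]
  have hq0 : 0 ≤ p ^ k := by positivity
  have hq1 : p ^ k ≤ 1 := pow_le_one₀ hp0 hp1
  have hEZle : ∫ ω, Z ω ∂μ ≤ Real.exp ((t * p ^ k + t ^ 2) * R.card) := by
    rw [hEZ, mul_comm _ (R.card : ℝ), Real.exp_nat_mul]
    have hlow : 0 < Real.exp t := Real.exp_pos t
    refine pow_le_pow_left₀ (by nlinarith) ?_ _
    have h1 := exp_sub_one_le htabs
    have h2 := Real.add_one_le_exp (t * p ^ k + t ^ 2)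
    nlinarith [sq_nonneg t]
  have hsub : {ω | δ * R.card ≤ s * (∑ r ∈ R, ∏ i ∈ F r, X i ω - p ^ k * R.card)}
      ⊆ {ω | Real.exp ((t * p ^ k + 2 * t ^ 2) * R.card) ≤ Z ω} := by
    intro ω hω
    simp only [Set.mem_ofPred_eq] at hω ⊢
    rw [hZexp, Real.exp_le_exp, ht2, ht]
    nlinarith [mul_le_mul_of_nonneg_left hω (by positivity : 0 ≤ δ / 2)]
  have hmarkov := mul_meas_ge_le_integral_of_nonneg (μ := μ) (f := Z)
    (ae_of_all _ fun ω => by rw [hZexp]; exact (Real.exp_pos _).le) hZint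
    (Real.exp ((t * p ^ k + 2 * t ^ 2) * R.card))
  calc _ ≤ μ.real {ω | Real.exp ((t * p ^ k + 2 * t ^ 2) * R.card) ≤ Z ω} :=
        measureReal_mono hsub
    _ ≤ (Real.exp ((t * p ^ k + t ^ 2) * R.card))
          / Real.exp ((t * p ^ k + 2 * t ^ 2) * R.card) := by
        rw [le_div_iff₀' (Real.exp_pos _)]
        exact hmarkov.trans hEZle
    _ = _ := by
        rw [← Real.exp_sub]
        congr 1
        rw [ht2]
        ring

end Multilinear

/-! ### Near-regularity of the random graph. -/

section Edges

variable {n : ℕ}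

open scoped Classical in
/-- The indicator of the presence of an edge. -/
noncomputable def edgeInd (e : Fin n × Fin n) (E : Graph n) : ℝ := if e ∈ E then 1 else 0

lemma measurable_edgeInd (e : Fin n × Fin n) : Measurable (edgeInd e) :=
  Measurable.ite (measurableSet_mem e) measurable_const measurable_const

open scoped Classical in
lemma edgeInd_comp (e : Fin n × Fin n) (f : Fin n × Fin n → Prop) :
    edgeInd e {i | f i} = if f e then 1 else 0 := rfl

lemma measurable_ite_prop : Measurable (fun q : Prop => open scoped Classical in
    if q then (1 : ℝ) else 0) := Measurable.of_discrete

lemma measurable_setOf_pi :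
    Measurable (fun f : Fin n × Fin n → Prop => ({i | f i} : Graph n)) :=
  measurable_set_iff.2 fun a => measurable_pi_apply a

/-- The law of the indicator that an edge is present. -/
noncomputable def edgePropLaw (n : ℕ) (p : unitInterval) (i : Fin n × Fin n) : Measure Prop :=
  unitInterval.toNNReal p • Measure.dirac (i ∈ {e : Fin n × Fin n | e.1 ≠ e.2})
    + unitInterval.toNNReal (unitInterval.symm p) • Measure.dirac False

lemma edgePropLaw_eq (p : unitInterval) (i : Fin n × Fin n) :
    edgePropLaw n p i = bernoulliMeasure (i ∈ {e : Fin n × Fin n | e.1 ≠ e.2}) False p := rfl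

instance (p : unitInterval) (i : Fin n × Fin n) : IsProbabilityMeasure (edgePropLaw n p i) := by
  rw [edgePropLaw_eq]; infer_instance

lemma graphLaw_eq_map (p : unitInterval) :
    graphLaw n p = (Measure.infinitePi (edgePropLaw n p)).map (fun f => {i | f i}) :=
  setBernoulli_eq_map _ p

lemma iIndepFun_edgeInd (p : unitInterval) :
    iIndepFun (fun e : Fin n × Fin n => edgeInd e) (graphLaw n p) := by
  rw [iIndepFun_iff_map_fun_eq_infinitePi_map measurable_edgeInd]
  have h : iIndepFun (fun (e : Fin n × Fin n) (f : Fin n × Fin n → Prop) => edgeInd e {i | f i})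
      (Measure.infinitePi (edgePropLaw n p)) :=
    iIndepFun_infinitePi (P := edgePropLaw n p) (X := fun _ q => open scoped Classical in
      if q then (1 : ℝ) else 0) fun _ => measurable_ite_prop
  have hm : ∀ e : Fin n × Fin n, Measurable fun f : Fin n × Fin n → Prop => edgeInd e {i | f i} :=
    fun e => (measurable_edgeInd e).comp measurable_setOf_pi
  rw [iIndepFun_iff_map_fun_eq_infinitePi_map hm] at h
  rw [graphLaw_eq_map, Measure.map_map (measurable_pi_lambda _ measurable_edgeInd)
    measurable_setOf_pi]
  simp_rw [Measure.map_map (measurable_edgeInd _) measurable_setOf_pi]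
  exact h

lemma integral_edgeInd (p : unitInterval) {e : Fin n × Fin n} (he : e.1 ≠ e.2) :
    ∫ E, edgeInd e E ∂(graphLaw n p) = p := by
  rw [graphLaw_eq_map, integral_map measurable_setOf_pi.aemeasurable
    (measurable_edgeInd e).aestronglyMeasurable]
  have h2 := integral_map (μ := Measure.infinitePi (edgePropLaw n p))
    (φ := fun f : Fin n × Fin n → Prop => f e)
    (f := fun q : Prop => open scoped Classical in if q then (1 : ℝ) else 0)
    (measurable_pi_apply e).aemeasurable measurable_ite_prop.aestronglyMeasurable
  rw [Measure.infinitePi_map_eval, edgePropLaw_eq, integral_bernoulliMeasure] at h2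
  simp only [edgeInd_comp]
  rw [← h2]
  simp [he]

open scoped Classical in
/-- The number of nodes `u` for which all the edges of `F u` are present. -/
noncomputable def blockCount (F : Fin n → Finset (Fin n × Fin n)) (E : Graph n) : ℕ :=
  (Finset.univ.filter fun u => (F u : Set (Fin n × Fin n)) ⊆ E).card

lemma prod_edgeInd (s : Finset (Fin n × Fin n)) (E : Graph n) :
    ∏ e ∈ s, edgeInd e E = open scoped Classical in if (s : Set (Fin n × Fin n)) ⊆ E then 1 else 0 := by
  classical
  split_ifs with h
  · exact Finset.prod_eq_one fun e he => if_pos (h he)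
  · obtain ⟨e, he, hn⟩ := Set.not_subset.1 h
    exact Finset.prod_eq_zero (Finset.mem_coe.1 he) (if_neg hn)

/-- Concentration of the number of nodes with all the edges of their block present. -/
lemma blockCount_concentration (p : unitInterval) (F : Fin n → Finset (Fin n × Fin n))
    (a b : Fin n) {k : ℕ} (hF : ∀ u v, u ≠ v → u ≠ a → u ≠ b → v ≠ a → v ≠ b →
      Disjoint (F u) (F v))
    (hoff : ∀ u, u ≠ a → u ≠ b → ∀ e ∈ F u, e.1 ≠ e.2)
    (hk : ∀ u, u ≠ a → u ≠ b → (F u).card = k) {ε : ℝ} (hε0 : 0 ≤ ε) (hε1 : ε ≤ 1)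
    (hn : 4 ≤ ε * n) :
    (graphLaw n p).real {E | ε * n < |(blockCount F E : ℝ) - (p : ℝ) ^ k * n|}
      ≤ 2 * Real.exp (-(ε ^ 2 / 16) * (n - 2)) := by
  classical
  -- At `u = a` or `u = b` a block may contain a loop or meet another block. Dropping these nodes
  -- changes the count by at most 2, which half of the allowed deviation absorbs since `4 ≤ ε * n`.
  set R : Finset (Fin n) := ({a, b} : Finset (Fin n))ᶜ with hR
  have hmem : ∀ u ∈ R, u ≠ a ∧ u ≠ b := fun u hu => by simpa [hR] using hu
  have hRcard : (R.card : ℝ) ≤ n := by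
    exact_mod_cast (Finset.card_le_univ R).trans_eq (Fintype.card_fin n)
  have hRcard' : (n : ℝ) - 2 ≤ R.card := by
    have h1 : R.card + ({a, b} : Finset (Fin n)).card = n := by
      rw [hR, Finset.card_compl, Fintype.card_fin, Nat.sub_add_cancel]
      exact (Finset.card_le_univ _).trans_eq (Fintype.card_fin n)
    have h2 : ({a, b} : Finset (Fin n)).card ≤ 2 := Finset.card_le_two
    have h3 : n ≤ R.card + 2 := by omega
    have : (n : ℝ) ≤ R.card + 2 := by exact_mod_cast h3
    linarith
  have hcount : ∀ E : Graph n, ∑ u ∈ R, ∏ e ∈ F u, edgeInd e E ≤ blockCount F E ∧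
      (blockCount F E : ℝ) ≤ ∑ u ∈ R, ∏ e ∈ F u, edgeInd e E + 2 := by
    intro E
    have hall : (blockCount F E : ℝ) = ∑ u, ∏ e ∈ F u, edgeInd e E := by
      simp_rw [prod_edgeInd]
      rw [Finset.sum_boole, blockCount]
    have hsplit := Finset.sum_add_sum_compl R (fun u => ∏ e ∈ F u, edgeInd e E)
    have hnn : ∀ u, 0 ≤ ∏ e ∈ F u, edgeInd e E ∧ ∏ e ∈ F u, edgeInd e E ≤ 1 := fun u => by
      rw [prod_edgeInd]; split_ifs <;> simp
    have h0 : 0 ≤ ∑ u ∈ Rᶜ, ∏ e ∈ F u, edgeInd e E := Finset.sum_nonneg fun u _ => (hnn u).1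
    have h1 : ∑ u ∈ Rᶜ, ∏ e ∈ F u, edgeInd e E ≤ 2 := by
      have := Finset.sum_le_card_nsmul Rᶜ (fun u => ∏ e ∈ F u, edgeInd e E) 1 fun u _ => (hnn u).2
      have h2 : (Rᶜ.card : ℝ) ≤ 2 := by
        rw [hR, compl_compl]
        exact_mod_cast Finset.card_le_two
      simp only [nsmul_eq_mul, mul_one] at this
      linarith
    constructor <;> linarith
  have hX := iIndepFun_edgeInd (n := n) p
  have hcher := fun {s : ℝ} (hs : s ^ 2 = 1) => chernoff_blocks hX measurable_edgeInd
    (fun e E => by unfold edgeInd; split_ifs <;> simp) R F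
    (fun u hu v hv huv => hF u v huv (hmem u hu).1 (hmem u hu).2 (hmem v hv).1 (hmem v hv).2)
    p.2.1 p.2.2 (fun u hu e he => integral_edgeInd p (hoff u (hmem u hu).1 (hmem u hu).2 e he))
    (fun u hu => hk u (hmem u hu).1 (hmem u hu).2) (δ := ε / 2) (by linarith) (by linarith) hs
  have hq0 : 0 ≤ (p : ℝ) ^ k := pow_nonneg p.2.1 k
  have hq1 : (p : ℝ) ^ k ≤ 1 := pow_le_one₀ p.2.1 p.2.2
  have hexp : Real.exp (-((ε / 2) ^ 2 / 4) * R.card) ≤ Real.exp (-(ε ^ 2 / 16) * (n - 2)) := by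
    rw [Real.exp_le_exp]
    nlinarith [sq_nonneg ε]
  let dev (s : ℝ) : Set (Graph n) :=
    {E | ε / 2 * R.card ≤ s * (∑ u ∈ R, ∏ e ∈ F u, edgeInd e E - (p : ℝ) ^ k * R.card)}
  suffices hsub : {E | ε * n < |(blockCount F E : ℝ) - (p : ℝ) ^ k * n|} ⊆ dev 1 ∪ dev (-1) by
    refine (measureReal_mono hsub).trans ((measureReal_union_le _ _).trans ?_)
    linarith [hcher (s := 1) (by norm_num), hcher (s := -1) (by norm_num)]
  intro E hE
  simp only [Set.mem_ofPred_eq, Set.mem_union, dev] at hE ⊢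
  obtain ⟨h1, h2⟩ := hcount E
  have e1 : (ε / 2) * R.card ≤ ε / 2 * n := by gcongr
  have e2 : (p : ℝ) ^ k * R.card ≤ (p : ℝ) ^ k * n := by gcongr
  have e3 : (p : ℝ) ^ k * (n - 2) ≤ (p : ℝ) ^ k * R.card := by gcongr
  rcases lt_abs.1 hE with h | h
  · left; linarith
  · right; linarith

/-- Near-regularity of a graph: the degrees, the numbers of paths of length two, and the numbers of
common out-neighbours are close to their expectations. -/
structure IsRegular (p ε : ℝ) (E : Graph n) : Prop where
  degIn : ∀ v, |(blockCount (fun u => {(u, v)}) E : ℝ) - p * n| ≤ ε * n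
  degOut : ∀ v, |(blockCount (fun u => {(v, u)}) E : ℝ) - p * n| ≤ ε * n
  paths : ∀ v w, v ≠ w → |(blockCount (fun u => {(u, v), (w, u)}) E : ℝ) - p ^ 2 * n| ≤ ε * n
  codeg : ∀ v w, v ≠ w → |(blockCount (fun u => {(v, u), (w, u)}) E : ℝ) - p ^ 2 * n| ≤ ε * n

lemma graphLaw_not_isRegular_le (p : unitInterval) {ε : ℝ} (hε0 : 0 ≤ ε) (hε1 : ε ≤ 1)
    (hn : 4 ≤ ε * n) :
    (graphLaw n p).real {E | ¬ IsRegular p ε E}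
      ≤ n ^ 2 * (8 * Real.exp (-(ε ^ 2 / 16) * (n - 2))) := by
  set B := 2 * Real.exp (-(ε ^ 2 / 16) * (n - 2)) with hB
  let bad (F : Fin n → Finset (Fin n × Fin n)) (k : ℕ) : Set (Graph n) :=
    {E | ε * n < |(blockCount F E : ℝ) - (p : ℝ) ^ k * n|}
  have hB0 : 0 ≤ B := by positivity
  have h1 : ∀ v : Fin n, (graphLaw n p).real (bad (fun u => {(u, v)}) 1) ≤ B := fun v =>
    blockCount_concentration p _ v v (by intros; simp; grind) (by simp +contextual) (by simp)
      hε0 hε1 hn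
  have h2 : ∀ v : Fin n, (graphLaw n p).real (bad (fun u => {(v, u)}) 1) ≤ B := fun v =>
    blockCount_concentration p _ v v (by intros; simp; grind)
      (by simp +contextual [eq_comm]) (by simp) hε0 hε1 hn
  have h3 : ∀ v w : Fin n, v ≠ w →
      (graphLaw n p).real (bad (fun u => {(u, v), (w, u)}) 2) ≤ B := fun v w hvw =>
    blockCount_concentration p _ v w (by intros; simp; grind) (by simp; grind)
      (by intro u h1 h2; apply Finset.card_pair; grind) hε0 hε1 hn
  have h4 : ∀ v w : Fin n, v ≠ w →
      (graphLaw n p).real (bad (fun u => {(v, u), (w, u)}) 2) ≤ B := fun v w hvw =>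
    blockCount_concentration p _ v w (by intros; simp; grind) (by simp; grind)
      (by intro u h1 h2; apply Finset.card_pair; grind) hε0 hε1 hn
  -- The degree events are repeated for every `w`, so that one union over pairs covers all four
  -- kinds of failure.
  let bad' (v w : Fin n) : Set (Graph n) :=
    (bad (fun u => {(u, v)}) 1 ∪ bad (fun u => {(v, u)}) 1) ∪
      ({E | v ≠ w ∧ E ∈ bad (fun u => {(u, v), (w, u)}) 2} ∪
        {E | v ≠ w ∧ E ∈ bad (fun u => {(v, u), (w, u)}) 2})
  have hbad' : ∀ v w, (graphLaw n p).real (bad' v w) ≤ 4 * B := by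
    intro v w
    have e3 : (graphLaw n p).real {E | v ≠ w ∧ E ∈ bad (fun u => {(u, v), (w, u)}) 2} ≤ B := by
      by_cases h : v = w
      · simp [h, hB0]
      · simpa [h] using h3 v w h
    have e4 : (graphLaw n p).real {E | v ≠ w ∧ E ∈ bad (fun u => {(v, u), (w, u)}) 2} ≤ B := by
      by_cases h : v = w
      · simp [h, hB0]
      · simpa [h] using h4 v w h
    refine (measureReal_union_le _ _).trans ?_
    refine (add_le_add (measureReal_union_le _ _) (measureReal_union_le _ _)).trans ?_
    linarith [h1 v, h2 v]
  calc (graphLaw n p).real {E | ¬ IsRegular p ε E}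
      ≤ (graphLaw n p).real (⋃ v, ⋃ w, bad' v w) := by
        refine measureReal_mono fun E hE => ?_
        by_contra hcon
        simp only [Set.mem_iUnion, not_exists] at hcon
        refine hE ⟨fun v => ?_, fun v => ?_, fun v w h => ?_, fun v w h => ?_⟩
        · have := hcon v v; simp [bad', bad] at this; exact this.1
        · have := hcon v v; simp [bad', bad] at this; exact this.2
        · have := hcon v w; simp [bad', bad] at this; exact this.2.1 h
        · have := hcon v w; simp [bad', bad] at this; exact this.2.2 h
    _ ≤ ∑ v : Fin n, ∑ w : Fin n, (graphLaw n p).real (bad' v w) :=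
        (measureReal_iUnion_fintype_le _).trans
          (Finset.sum_le_sum fun v _ => measureReal_iUnion_fintype_le _)
    _ ≤ ∑ v : Fin n, ∑ w : Fin n, 4 * B :=
        Finset.sum_le_sum fun v _ => Finset.sum_le_sum fun w _ => hbad' v w
    _ = _ := by simp [hB]; ring

end Edges

/-- The random graph is near-regular with high probability. -/
lemma tendsto_graphLaw_not_isRegular (p : unitInterval) {ε : ℝ} (hε0 : 0 < ε) (hε1 : ε ≤ 1) :
    Tendsto (fun n : ℕ => (graphLaw n p).real {E | ¬ IsRegular p ε E}) atTop (𝓝 0) := by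
  have hc : 0 < ε ^ 2 / 16 := by positivity
  have hlim : Tendsto (fun n : ℕ => (n : ℝ) ^ 2 * (8 * Real.exp (-(ε ^ 2 / 16) * (n - 2))))
      atTop (𝓝 0) := by
    have h := (Real.tendsto_pow_mul_exp_neg_atTop_nhds_zero 2).comp
      (tendsto_natCast_atTop_atTop.const_mul_atTop hc)
    have h2 := h.const_mul (8 * Real.exp (ε ^ 2 / 16 * 2) / (ε ^ 2 / 16) ^ 2)
    rw [mul_zero] at h2
    refine h2.congr fun n => ?_
    have : Real.exp (-(ε ^ 2 / 16) * (n - 2))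
        = Real.exp (ε ^ 2 / 16 * 2) * Real.exp (-(ε ^ 2 / 16 * n)) := by
      rw [← Real.exp_add]; ring_nf
    simp only [Function.comp_apply, this]
    field_simp
  refine tendsto_of_tendsto_of_tendsto_of_le_of_le' tendsto_const_nhds hlim
    (Eventually.of_forall fun _ => measureReal_nonneg) ?_
  have h4 : ∀ᶠ n : ℕ in atTop, 4 ≤ ε * n :=
    (tendsto_natCast_atTop_atTop.const_mul_atTop hε0).eventually_ge_atTop 4
  filter_upwards [h4] with n hn using graphLaw_not_isRegular_le p hε0.le hε1 hn

/-! ### Parity of random rows via the character of `𝔽₂`. -/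

/-- The nontrivial additive character of `𝔽₂`. -/
noncomputable def signChar (x : ZMod 2) : ℝ := if x = 0 then 1 else -1

lemma signChar_add (x y : ZMod 2) : signChar (x + y) = signChar x * signChar y := by
  have h : ∀ x y : ZMod 2, x + y = 0 ↔ (x = 0 ↔ y = 0) := by decide
  simp only [signChar, h]
  by_cases hx : x = 0 <;> by_cases hy : y = 0 <;> simp [hx, hy]

lemma signChar_sum {ι : Type*} (s : Finset ι) (f : ι → ZMod 2) :
    signChar (∑ i ∈ s, f i) = ∏ i ∈ s, signChar (f i) := by
  classical
  induction s using Finset.induction_on with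
  | empty => simp [signChar]
  | insert a s ha ih => rw [Finset.sum_insert ha, Finset.prod_insert ha, signChar_add, ih]

lemma abs_signChar (x : ZMod 2) : |signChar x| = 1 := by
  unfold signChar; split_ifs <;> simp

section Parity

variable {n : ℕ}

open scoped Classical in
/-- The number of in-neighbours of `u` in `S`. -/
noncomputable def inCount (E : Graph n) (S : Finset (Fin n)) (u : Fin n) : ℕ :=
  (S.filter fun w => w ∈ inNbrs E u).card

lemma measurableSet_orthogonal (S : Finset (Fin n)) (R : Finset (ℕ × Fin n)) :
    MeasurableSet {X : Coeffs n | ∀ r ∈ R, ∑ w ∈ S, X (r.1, r.2, w) = 0} := by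
  have : {X : Coeffs n | ∀ r ∈ R, ∑ w ∈ S, X (r.1, r.2, w) = 0}
      = ⋂ r ∈ R, (fun X : Coeffs n => ∑ w ∈ S, X (r.1, r.2, w)) ⁻¹' {0} := by
    ext; simp
  rw [this]
  refine Finset.measurableSet_biInter R fun r _ => ?_
  have hsum : Measurable fun X : Coeffs n => ∑ w ∈ S, X (r.1, r.2, w) :=
    Finset.measurable_fun_sum S fun w _ => measurable_pi_apply _
  exact hsum (measurableSet_singleton 0)

/-- The probability that the linear combinations of the rounds and nodes in `R` are all
orthogonal to the indicator vector of `S`. -/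
lemma coeffKernel_orthogonal (β : ℝ) (E : Graph n) (S : Finset (Fin n)) (R : Finset (ℕ × Fin n)) :
    (coeffKernel n β E).real {X | ∀ r ∈ R, ∑ w ∈ S, X (r.1, r.2, w) = 0}
      = ∏ r ∈ R, (1 / 2 + 1 / 2 * (1 - 2 * (coeffProb β (inDeg E r.2) : ℝ)) ^ inCount E S r.2) := by
  classical
  have hμ : coeffKernel n β E = Measure.infinitePi (entryLaw β E) := rfl
  have hm : ∀ i : ℕ × Fin n × Fin n, Measurable fun X : Coeffs n => signChar (X i) := fun i =>
    (Measurable.of_discrete (f := signChar)).comp (measurable_pi_apply i)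
  have hX : iIndepFun (fun (i : ℕ × Fin n × Fin n) (X : Coeffs n) => signChar (X i))
      (Measure.infinitePi (entryLaw β E)) :=
    iIndepFun_infinitePi (P := entryLaw β E) (X := fun _ => signChar) fun _ => Measurable.of_discrete
  let F : ℕ × Fin n → Finset (ℕ × Fin n × Fin n) := fun r => S.image fun w => (r.1, r.2, w)
  have hinj : ∀ r : ℕ × Fin n, Set.InjOn (fun w => (r.1, r.2, w)) (S : Set (Fin n)) :=
    fun r a _ b _ h => by simpa using h
  have hF : (R : Set (ℕ × Fin n)).PairwiseDisjoint F := by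
    intro r _ r' _ hne
    rw [Function.onFun, Finset.disjoint_left]
    simp only [F, Finset.mem_image]
    rintro _ ⟨a, _, rfl⟩ ⟨b, _, h⟩
    simp only [Prod.mk.injEq] at h
    exact hne (Prod.ext h.1.symm h.2.1.symm)
  have hint := integral_prod_affine_monomials hX hm (fun i X => (abs_signChar _).le) R F hF
    (1 / 2) (1 / 2)
  have hE : ∀ i : ℕ × Fin n × Fin n, ∫ X, signChar (X i) ∂(Measure.infinitePi (entryLaw β E))
      = if i.2.2 ∈ inNbrs E i.2.1 then 1 - 2 * (coeffProb β (inDeg E i.2.1) : ℝ) else 1 := by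
    intro i
    have h2 := integral_map (μ := Measure.infinitePi (entryLaw β E))
      (φ := fun X : Coeffs n => X i) (f := signChar)
      (measurable_pi_apply i).aemeasurable Measurable.of_discrete.aestronglyMeasurable
    rw [Measure.infinitePi_map_eval, entryLaw, integral_bernoulliMeasure] at h2
    rw [← h2]
    split_ifs
    · simp [signChar]
      ring
    · simp [signChar]
  -- The indicator of a zero sum is `(1 + χ) / 2`, with `χ` the character of the sum, and `χ` is a
  -- monomial in the independent signs of one row.
  have hind : ∀ X : Coeffs n, ∏ r ∈ R, (1 / 2 + 1 / 2 * ∏ i ∈ F r, signChar (X i))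
      = Set.indicator {X : Coeffs n | ∀ r ∈ R, ∑ w ∈ S, X (r.1, r.2, w) = 0} 1 X := by
    intro X
    have hr : ∀ r, ∏ i ∈ F r, signChar (X i) = signChar (∑ w ∈ S, X (r.1, r.2, w)) := fun r => by
      rw [signChar_sum, Finset.prod_image (hinj r)]
    simp only [hr]
    by_cases h : ∀ r ∈ R, ∑ w ∈ S, X (r.1, r.2, w) = 0
    · rw [Set.indicator_of_mem (by exact h)]
      refine Finset.prod_eq_one fun r hrR => ?_
      rw [h r hrR]
      norm_num [signChar]
    · rw [Set.indicator_of_notMem (by exact h)]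
      push Not at h
      obtain ⟨r, hrR, h0⟩ := h
      refine Finset.prod_eq_zero hrR ?_
      norm_num [signChar, h0]
  rw [hμ, ← integral_indicator_one (measurableSet_orthogonal S R)]
  simp_rw [← hind]
  rw [hint]
  refine Finset.prod_congr rfl fun r _ => ?_
  simp only [hE]
  rw [Finset.prod_image (hinj r), Finset.prod_ite]
  simp [inCount]

end Parity

/-! ### From failure to decode to an undetected set. -/

section Decoding

variable {n : ℕ}

/-- If a node cannot decode all packets after round `T`, then all the linear combinations it
received are orthogonal to a nonempty set of packets, none of which it received in round 1. -/
lemma exists_orthogonal_of_not_canDecode {L : ℕ} {E : Graph n} {X : Coeffs n} {T : ℕ} (hT : 1 ≤ T)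
    {v : Fin n} (h : ¬ CanDecode L E X T v) :
    ∃ S : Finset (Fin n), S.Nonempty ∧ v ∉ S ∧ (∀ u ∈ inNbrs E v, u ∉ S) ∧
      ∀ t ∈ Finset.Icc 2 T, ∀ u ∈ inNbrs E v, ∑ w ∈ S, X (t, u, w) = 0 := by
  classical
  unfold CanDecode at h
  push Not at h
  obtain ⟨P, Q, hv, hb, hne⟩ := h
  have : ∃ w l, P w l ≠ Q w l := by
    by_contra hcon
    push Not at hcon
    exact hne (funext fun w => funext fun l => hcon w l)
  obtain ⟨w₀, l, hl⟩ := this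
  have hval : ∀ w, P w l - Q w l = if P w l ≠ Q w l then 1 else 0 := by
    intro w
    generalize P w l = a
    generalize Q w l = b
    revert a b
    decide
  -- One bit `l` where `P` and `Q` differ suffices: over `𝔽₂` the difference there is the indicator
  -- of its support.
  refine ⟨Finset.univ.filter fun w => P w l ≠ Q w l, ⟨w₀, by simpa using hl⟩, by simp [hv],
    fun u hu => ?_, fun t ht u hu => ?_⟩
  · have := hb 1 (by simp [hT]) u hu
    simp only [broadcast, le_refl, if_true] at this
    simp [this]
  · rw [Finset.mem_Icc] at ht
    have h1 := congrFun (hb t (by simp; omega) u hu) l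
    simp only [broadcast, show ¬ t ≤ 1 by omega, if_false, Finset.sum_apply, Pi.smul_apply,
      smul_eq_mul] at h1
    rw [← sub_eq_zero, ← Finset.sum_sub_distrib] at h1
    simp_rw [← mul_sub, hval] at h1
    rw [Finset.sum_filter]
    refine Eq.trans ?_ h1
    exact Finset.sum_congr rfl fun w _ => by split_ifs <;> simp

lemma not_canDecode_of_lt_allcastTime {L T : ℕ} {ω : Graph n × Coeffs n}
    (h : (T : ℕ∞) < allcastTime L ω) : ∃ v, ¬ CanDecode L ω.1 ω.2 T v := by
  by_contra hcon
  push Not at hcon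
  exact absurd h (not_lt.2 (iInf₂_le T hcon))

end Decoding

/-! ### Double counting in near-regular graphs. -/

section Counting

variable {n : ℕ} {E : Graph n} {S : Finset (Fin n)} {v : Fin n} {p ε : ℝ}

open scoped Classical in
/-- The in-neighbours of `v`, as a finset. -/
noncomputable def inFinset (E : Graph n) (v : Fin n) : Finset (Fin n) :=
  Finset.univ.filter fun u => u ∈ inNbrs E v

@[simp]
lemma mem_inFinset {u : Fin n} : u ∈ inFinset E v ↔ u ∈ inNbrs E v := by simp [inFinset]

lemma card_inFinset : (inFinset E v).card = inDeg E v := by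
  rw [inDeg, ← Set.ncard_coe_finset]
  congr
  ext
  simp

lemma blockCount_in : blockCount (fun u => {(u, v)}) E = inDeg E v := by
  rw [← card_inFinset, blockCount, inFinset]
  congr 1
  ext u
  simp only [Finset.coe_singleton, Set.singleton_subset_iff, Finset.mem_filter_univ]
  exact Iff.rfl

lemma IsRegular.abs_inDeg (h : IsRegular p ε E) (v : Fin n) :
    |(inDeg E v : ℝ) - p * n| ≤ ε * n := by
  have := h.degIn v
  rwa [blockCount_in] at this

open scoped Classical in
lemma inCount_eq_sum (u : Fin n) :
    (inCount E S u : ℝ) = ∑ w ∈ S, if (w, u) ∈ E then 1 else 0 := by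
  rw [Finset.sum_boole]; rfl

lemma inCount_le (u : Fin n) : inCount E S u ≤ S.card := by
  classical exact Finset.card_filter_le _ _

open scoped Classical in
lemma blockCount_eq_sum (F : Fin n → Finset (Fin n × Fin n)) :
    (blockCount F E : ℝ) = ∑ u, if (F u : Set (Fin n × Fin n)) ⊆ E then 1 else 0 := by
  rw [Finset.sum_boole]; rfl

/-- Both sides count paths `w → u → v` with `w ∈ S`. -/
lemma sum_inCount_inFinset :
    ∑ u ∈ inFinset E v, (inCount E S u : ℝ)
      = ∑ w ∈ S, (blockCount (fun u => {(u, v), (w, u)}) E : ℝ) := by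
  classical
  simp_rw [inCount_eq_sum, blockCount_eq_sum]
  rw [Finset.sum_comm]
  refine Finset.sum_congr rfl fun w _ => ?_
  rw [inFinset, Finset.sum_filter]
  refine Finset.sum_congr rfl fun u _ => ?_
  by_cases h1 : (u, v) ∈ E <;> by_cases h2 : (w, u) ∈ E <;>
    simp [Set.insert_subset_iff, inNbrs, h1, h2]

lemma sum_inCount :
    ∑ u, (inCount E S u : ℝ) = ∑ w ∈ S, (blockCount (fun u => {(w, u)}) E : ℝ) := by
  classical
  simp_rw [inCount_eq_sum, blockCount_eq_sum]
  rw [Finset.sum_comm]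
  simp

lemma sum_inCount_sq :
    ∑ u, (inCount E S u : ℝ) ^ 2
      = ∑ w ∈ S, ∑ w' ∈ S, (blockCount (fun u => {(w, u), (w', u)}) E : ℝ) := by
  classical
  simp_rw [inCount_eq_sum, blockCount_eq_sum, sq, Finset.sum_mul_sum]
  rw [Finset.sum_comm]
  refine Finset.sum_congr rfl fun w _ => ?_
  rw [Finset.sum_comm]
  refine Finset.sum_congr rfl fun w' _ => Finset.sum_congr rfl fun u _ => ?_
  by_cases h1 : (w', u) ∈ E <;> by_cases h2 : (w, u) ∈ E <;>
    simp [Set.insert_subset_iff, h1, h2]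

lemma blockCount_le (F : Fin n → Finset (Fin n × Fin n)) : blockCount F E ≤ n :=
  (Finset.card_le_univ _).trans_eq (Fintype.card_fin n)

lemma IsRegular.le_sum_inCount_inFinset (h : IsRegular p ε E) (hv : v ∉ S) :
    (S.card : ℝ) * ((p ^ 2 - ε) * n) ≤ ∑ u ∈ inFinset E v, (inCount E S u : ℝ) := by
  rw [sum_inCount_inFinset, ← nsmul_eq_mul]
  refine Finset.card_nsmul_le_sum S _ _ fun w hw => ?_
  have := (abs_le.1 (h.paths v w fun hvw => hv (hvw ▸ hw))).1
  linarith

/-- In a near-regular graph, few nodes have substantially fewer in-neighbours in `S` than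
expected. -/
lemma IsRegular.card_low_inCount (h : IsRegular p ε E) (hp0 : 0 < p) (hp1 : p ≤ 1) :
    ((Finset.univ.filter fun u => 2 * (inCount E S u : ℝ) < p * S.card).card : ℝ)
      * (p ^ 2 * S.card ^ 2 / 4) ≤ S.card * n + 3 * ε * S.card ^ 2 * n := by
  classical
  set k : ℝ := (S.card : ℝ) with hk
  -- The sign of `ε` is not assumed; a regularity bound at any node of `S` supplies it.
  have hεn : 0 ≤ ε * n ∨ S = ∅ := by
    rcases S.eq_empty_or_nonempty with h0 | ⟨w, _⟩
    · exact Or.inr h0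
    · exact Or.inl ((abs_nonneg _).trans (h.degIn w))
  rcases hεn with hεn | h0
  swap
  · simp [hk, h0]
  have h1 : k * ((p - ε) * n) ≤ ∑ u, (inCount E S u : ℝ) := by
    rw [sum_inCount, hk, ← nsmul_eq_mul]
    refine Finset.card_nsmul_le_sum S _ _ fun w _ => ?_
    have := (abs_le.1 (h.degOut w)).1
    linarith
  have h2 : ∑ u, (inCount E S u : ℝ) ^ 2 ≤ k * (n + k * ((p ^ 2 + ε) * n)) := by
    rw [sum_inCount_sq, hk, ← nsmul_eq_mul]
    refine Finset.sum_le_card_nsmul S _ _ fun w hw => ?_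
    rw [← Finset.add_sum_erase S _ hw]
    -- The diagonal pair `w' = w` is bounded trivially by `n`; it produces the term `|S| n`.
    refine add_le_add (by exact_mod_cast blockCount_le _) ?_
    have h3 : ∑ w' ∈ S.erase w, (blockCount (fun u => {(w, u), (w', u)}) E : ℝ)
        ≤ (S.erase w).card • ((p ^ 2 + ε) * n) := by
      refine Finset.sum_le_card_nsmul _ _ _ fun w' hw' => ?_
      have := (abs_le.1 (h.codeg w w' (Finset.ne_of_mem_erase hw').symm)).2
      linarith
    rw [nsmul_eq_mul] at h3
    refine h3.trans ?_
    have h4 : ((S.erase w).card : ℝ) ≤ S.card := by exact_mod_cast Finset.card_erase_le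
    have h5 : 0 ≤ (p ^ 2 + ε) * n := by nlinarith [sq_nonneg p, Nat.cast_nonneg (α := ℝ) n]
    exact mul_le_mul_of_nonneg_right h4 h5
  -- The `p²` terms cancel, leaving `(1 + 2p) ε k² n` beside the diagonal. Chebyshev then finishes,
  -- each low node contributing at least `(pk/2)²`.
  have h3 : ∑ u : Fin n, ((inCount E S u : ℝ) - p * k) ^ 2 ≤ k * n + 3 * ε * k ^ 2 * n := by
    have : ∑ u : Fin n, ((inCount E S u : ℝ) - p * k) ^ 2
        = ∑ u, (inCount E S u : ℝ) ^ 2 - 2 * p * k * ∑ u, (inCount E S u : ℝ)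
          + n * (p * k) ^ 2 := by
      rw [Finset.mul_sum, ← Finset.sum_sub_distrib]
      simp_rw [sub_sq, Finset.sum_add_distrib]
      congr 1
      · exact Finset.sum_congr rfl fun u _ => by ring
      · simp
    rw [this]
    have hk0 : 0 ≤ k := Nat.cast_nonneg _
    have h5 := mul_le_mul_of_nonneg_left h1 (by positivity : 0 ≤ 2 * p * k)
    have h6 : 0 ≤ (1 - p) * (k ^ 2 * (ε * n)) :=
      mul_nonneg (by linarith) (mul_nonneg (sq_nonneg _) hεn)
    nlinarith
  rw [← nsmul_eq_mul]
  refine le_trans ?_ h3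
  refine (Finset.card_nsmul_le_sum _ (fun u => ((inCount E S u : ℝ) - p * k) ^ 2) _ ?_).trans
    (Finset.sum_le_univ_sum_of_nonneg fun u => sq_nonneg _)
  intro u hu
  have hu' : 2 * (inCount E S u : ℝ) < p * k := by simpa using hu
  have : 0 ≤ (inCount E S u : ℝ) := Nat.cast_nonneg _
  nlinarith

end Counting

/-! ### Bounds for a single row. -/

section RowFactor

/-- The probability that a random linear combination is orthogonal to a set meeting its support
in `j` elements, each coefficient being equal to one with probability `q`. -/
noncomputable def rowFactor (q : ℝ) (j : ℕ) : ℝ := 1 / 2 + 1 / 2 * (1 - 2 * q) ^ j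

variable {q : ℝ} {j : ℕ}

lemma rowFactor_nonneg (hq : q ≤ 1 / 2) : 0 ≤ rowFactor q j := by
  have : 0 ≤ (1 - 2 * q) ^ j := pow_nonneg (by linarith) j
  unfold rowFactor; linarith

lemma rowFactor_le (hq : q ≤ 1 / 2) : rowFactor q j ≤ (1 + Real.exp (-(2 * (q * j)))) / 2 := by
  have h : (1 - 2 * q) ^ j ≤ Real.exp (-(2 * q)) ^ j :=
    pow_le_pow_left₀ (by linarith) (by linarith [Real.add_one_le_exp (-(2 * q))]) j
  rw [← Real.exp_nat_mul] at h
  have e : (j : ℝ) * -(2 * q) = -(2 * (q * j)) := by ring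
  rw [e] at h
  unfold rowFactor; linarith

lemma rowFactor_le_one (hq0 : 0 ≤ q) (hq : q ≤ 1 / 2) : rowFactor q j ≤ 1 := by
  refine (rowFactor_le hq).trans ?_
  have : Real.exp (-(2 * (q * j))) ≤ 1 := Real.exp_le_one_iff.2 (by nlinarith [mul_nonneg hq0 (Nat.cast_nonneg (α := ℝ) j)])
  linarith

lemma one_add_exp_neg_le {y : ℝ} (hy0 : 0 ≤ y) (hy : y ≤ 1 / 4) :
    (1 + Real.exp (-(2 * y))) / 2 ≤ Real.exp (-(3 / 4 * y)) := by
  have h1 : Real.exp (-(2 * y)) ≤ 1 - 2 * y + 2 * y ^ 2 := by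
    -- Here `(1 + 2y + 2y²)(1 - 2y + 2y²) = 1 + 4y⁴ ≥ 1`.
    rw [Real.exp_neg]
    refine (inv_anti₀ (by positivity)
      (Real.quadratic_le_exp_of_nonneg (by positivity : 0 ≤ 2 * y))).trans ?_
    rw [inv_le_iff_one_le_mul₀ (by positivity)]
    nlinarith [sq_nonneg (y ^ 2)]
  have h2 := Real.add_one_le_exp (-(3 / 4 * y))
  nlinarith

end RowFactor

/-! ### One round, for small and for large sets. -/

section Products

variable {n : ℕ} {E : Graph n} {S : Finset (Fin n)} {v : Fin n} {p ε : ℝ} {q : Fin n → ℝ}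

/-- The bound for the probability that a small set `S` is not detected in one round. -/
lemma IsRegular.prod_rowFactor_le_of_small (h : IsRegular p ε E) (hv : v ∉ S) {ql qh : ℝ}
    (hql : 0 ≤ ql) (hq : ∀ u, ql ≤ q u ∧ q u ≤ qh) (hqh : qh ≤ 1 / 2) (hS : qh * S.card ≤ 1 / 4) :
    ∏ u ∈ inFinset E v, rowFactor (q u) (inCount E S u)
      ≤ Real.exp (-(3 / 4 * (ql * (S.card * ((p ^ 2 - ε) * n))))) := by
  calc ∏ u ∈ inFinset E v, rowFactor (q u) (inCount E S u)
      ≤ ∏ u ∈ inFinset E v, Real.exp (-(3 / 4 * (ql * inCount E S u))) := by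
        refine Finset.prod_le_prod (fun u _ => rowFactor_nonneg ((hq u).2.trans hqh)) fun u _ => ?_
        have hj : (inCount E S u : ℝ) ≤ S.card := by exact_mod_cast inCount_le u
        have hj0 : 0 ≤ (inCount E S u : ℝ) := Nat.cast_nonneg _
        have hqu : 0 ≤ q u := hql.trans (hq u).1
        refine (rowFactor_le ((hq u).2.trans hqh)).trans ((one_add_exp_neg_le (by positivity)
          ((mul_le_mul (hq u).2 hj hj0 (hqu.trans (hq u).2)).trans hS)).trans ?_)
        rw [Real.exp_le_exp]
        have := mul_le_mul_of_nonneg_right (hq u).1 hj0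
        linarith
    _ = Real.exp (-(3 / 4 * (ql * ∑ u ∈ inFinset E v, (inCount E S u : ℝ)))) := by
        rw [← Real.exp_sum, Finset.mul_sum, Finset.mul_sum, Finset.sum_neg_distrib]
    _ ≤ _ := by
        rw [Real.exp_le_exp]
        have := mul_le_mul_of_nonneg_left (h.le_sum_inCount_inFinset hv) hql
        linarith

/-- The bound for the probability that a large set `S` is not detected in one round. -/
lemma IsRegular.prod_rowFactor_le_of_large (h : IsRegular p ε E) (hp0 : 0 < p) (hp1 : p ≤ 1)
    {ql : ℝ} (hql : 0 ≤ ql) (hq : ∀ u, ql ≤ q u ∧ q u ≤ 1 / 2) (hS : 1 ≤ ε * S.card) {c : ℝ}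
    (hc : c ≤ p - ε - 16 * ε / p ^ 2) :
    ∏ u ∈ inFinset E v, rowFactor (q u) (inCount E S u)
      ≤ ((1 + Real.exp (-(ql * (p * S.card)))) / 2) ^ (c * n) := by
  classical
  set ρ := (1 + Real.exp (-(ql * (p * S.card)))) / 2 with hρ
  have hρ0 : 0 < ρ := by positivity
  have hρ1 : ρ ≤ 1 := by
    have : Real.exp (-(ql * (p * S.card))) ≤ 1 := by
      rw [Real.exp_le_one_iff, neg_nonpos]; positivity
    linarith
  set low := Finset.univ.filter fun u => 2 * (inCount E S u : ℝ) < p * S.card with hlow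
  have hk0 : (0 : ℝ) < S.card := by
    by_contra hcon
    have : (S.card : ℝ) = 0 := le_antisymm (not_lt.1 hcon) (Nat.cast_nonneg _)
    rw [this] at hS; linarith
  have hlowcard : (low.card : ℝ) ≤ 16 * ε / p ^ 2 * n := by
    have h1 := h.card_low_inCount (S := S) hp0 hp1
    rw [← hlow] at h1
    -- Since `1 ≤ ε|S|`, the diagonal term is absorbed into a fourth `ε|S|² n`.
    have h2 : (S.card : ℝ) * n + 3 * ε * S.card ^ 2 * n ≤ 4 * ε * S.card ^ 2 * n := by
      have : (S.card : ℝ) * n * 1 ≤ (S.card : ℝ) * n * (ε * S.card) := by gcongr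
      nlinarith
    have h3 : (low.card : ℝ) * (p ^ 2 * S.card ^ 2 / 4)
        ≤ (16 * ε / p ^ 2 * n) * (p ^ 2 * S.card ^ 2 / 4) := by
      refine (h1.trans h2).trans_eq ?_
      field_simp
      ring
    exact le_of_mul_le_mul_right h3 (by positivity)
  have hgood : c * n ≤ ((inFinset E v \ low).card : ℝ) := by
    have h1 : (inFinset E v).card ≤ (inFinset E v \ low).card + low.card :=
      Finset.card_le_card_sdiff_add_card
    have h2 : ((inFinset E v).card : ℝ) ≤ (inFinset E v \ low).card + low.card := by
      exact_mod_cast h1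
    rw [card_inFinset] at h2
    have h3 := (abs_le.1 (h.abs_inDeg v)).1
    have h4 : c * n ≤ (p - ε - 16 * ε / p ^ 2) * n :=
      mul_le_mul_of_nonneg_right hc (Nat.cast_nonneg _)
    linarith
  calc ∏ u ∈ inFinset E v, rowFactor (q u) (inCount E S u)
      ≤ ∏ u ∈ inFinset E v \ low, rowFactor (q u) (inCount E S u) :=
        Finset.prod_le_prod_of_subset_of_le_one Finset.sdiff_subset
          (fun u _ => rowFactor_nonneg (hq u).2)
          (fun u _ _ => rowFactor_le_one (hql.trans (hq u).1) (hq u).2)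
    _ ≤ ∏ u ∈ inFinset E v \ low, ρ := by
        refine Finset.prod_le_prod (fun u _ => rowFactor_nonneg (hq u).2) fun u hu => ?_
        refine (rowFactor_le (hq u).2).trans ?_
        have hj : p * S.card ≤ 2 * (inCount E S u : ℝ) := by
          simpa [hlow] using (Finset.mem_sdiff.1 hu).2
        rw [hρ]
        have h1 : Real.exp (-(2 * (q u * inCount E S u))) ≤ Real.exp (-(ql * (p * S.card))) := by
          rw [Real.exp_le_exp, neg_le_neg_iff]
          calc ql * (p * S.card) ≤ q u * (2 * inCount E S u) :=
                mul_le_mul (hq u).1 hj (by positivity) (hql.trans (hq u).1)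
            _ = _ := by ring
        linarith
    _ = ρ ^ ((inFinset E v \ low).card : ℝ) := by rw [Finset.prod_const, Real.rpow_natCast]
    _ ≤ ρ ^ (c * n) := Real.rpow_le_rpow_of_exponent_ge hρ0 hρ1 hgood

end Products

/-! ### Asymptotics and summation over all sets. -/

section Asymptotics

lemma tendsto_log_div_natCast : Tendsto (fun n : ℕ => Real.log n / n) atTop (𝓝 0) :=
  (Real.isLittleO_log_id_atTop.tendsto_div_nhds_zero).comp tendsto_natCast_atTop_atTop

/-- In a near-regular graph, all the coefficient probabilities are comparable to
`log n / (p n)`. -/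
lemma eventually_coeffProb_bounds {p β : ℝ} (hp0 : 0 < p) (hp1 : p ≤ 1) (hβ : 8 < β) :
    ∀ᶠ n : ℕ in atTop, ∀ E : Graph n, IsRegular p (p ^ 4 / 200) E → ∀ u,
      7 * Real.log n / (p * n) ≤ coeffProb β (inDeg E u) ∧
        (coeffProb β (inDeg E u) : ℝ) ≤ 2 * β * Real.log n / (p * n) := by
  have hlog : Tendsto (fun n : ℕ => Real.log n) atTop atTop :=
    Real.tendsto_log_atTop.comp tendsto_natCast_atTop_atTop
  have hsmall : ∀ᶠ n : ℕ in atTop, Real.log n / n < p / 7 :=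
    tendsto_log_div_natCast.eventually_lt_const (by positivity)
  -- The threshold makes `log (p n / 2) ≥ (19/20) log n`.
  filter_upwards [eventually_ge_atTop 2, hlog.eventually_ge_atTop (-20 * Real.log (p / 2)), hsmall]
    with n hn2 hn hsm E hE u
  have hn0 : (0 : ℝ) < n := by positivity
  have hlog0 : 0 < Real.log n := Real.log_pos (by exact_mod_cast hn2)
  have hp4 : p ^ 4 ≤ p := by
    simpa using pow_le_pow_of_le_one hp0.le hp1 (show 1 ≤ 4 by norm_num)
  have hd := abs_le.1 (hE.abs_inDeg u)
  have hpn : 0 < p * n := by positivity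
  have h4n : p ^ 4 * n ≤ p * n := mul_le_mul_of_nonneg_right hp4 hn0.le
  set d : ℝ := (inDeg E u : ℝ) with hdd
  have hdl : p * n / 2 ≤ d := by linarith
  have hdu : d ≤ 201 / 200 * (p * n) := by linarith
  have hd0 : 0 < d := by linarith
  have hdn : d ≤ n := by
    rw [hdd, ← blockCount_in]
    exact_mod_cast blockCount_le _
  have hlogd : Real.log d ≤ Real.log n := Real.log_le_log hd0 hdn
  have hlogd' : 19 / 20 * Real.log n ≤ Real.log d := by
    have h1 : Real.log (p / 2 * n) ≤ Real.log d := Real.log_le_log (by positivity) (by linarith)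
    rw [Real.log_mul (by positivity) hn0.ne'] at h1
    linarith
  have hlogd0 : 0 ≤ Real.log d := by linarith
  have hval : (coeffProb β (inDeg E u) : ℝ) = max 0 (min 1 (β * Real.log d / d)) := by
    rw [coeffProb, Set.coe_projIcc]
  rw [hval]
  constructor
  · refine le_max_of_le_right (le_min ?_ ?_)
    · rw [div_le_one hpn]
      rw [div_lt_iff₀ hn0] at hsm
      linarith
    · rw [div_le_div_iff₀ hpn hd0]
      -- The constant 7 is available because `8 · 19/20` exceeds `7 · 201/200`.
      have h1 : 8 * (19 / 20 * Real.log n) ≤ β * Real.log d :=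
        mul_le_mul hβ.le hlogd' (by positivity) (by linarith)
      calc 7 * Real.log n * d ≤ 7 * Real.log n * (201 / 200 * (p * n)) := by gcongr
        _ ≤ 8 * (19 / 20 * Real.log n) * (p * n) := by
          have := mul_pos hlog0 hpn
          nlinarith
        _ ≤ _ := by gcongr
  · have h0 : 0 ≤ 2 * β * Real.log n / (p * n) := by positivity
    refine max_le h0 ((min_le_right _ _).trans ?_)
    rw [div_le_div_iff₀ hd0 hpn]
    have : 0 ≤ β * Real.log n := by positivity
    calc β * Real.log d * (p * n) ≤ β * Real.log n * (p * n) := by gcongr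
      _ ≤ β * Real.log n * (2 * d) := mul_le_mul_of_nonneg_left (by linarith) this
      _ = _ := by ring

section Undetected

variable {n : ℕ} {E : Graph n} {S : Finset (Fin n)} {v : Fin n} {p : ℝ} {q : Fin n → ℝ}

lemma IsRegular.undetected_le_of_small (h : IsRegular p (p ^ 4 / 200) E) (hp0 : 0 < p)
    (hp1 : p ≤ 1) (hv : v ∉ S) (hn : 1 < n) {qh : ℝ}
    (hq : ∀ u, 7 * Real.log n / (p * n) ≤ q u ∧ q u ≤ qh) (hqh : qh ≤ 1 / 2)
    (hS : qh * S.card ≤ 1 / 4) {M : ℕ} (hM : 1 ≤ M * p) :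
    (∏ u ∈ inFinset E v, rowFactor (q u) (inCount E S u)) ^ M ≤ (1 / (n : ℝ) ^ 4) ^ S.card := by
  have hn0 : (0 : ℝ) < n := by positivity
  have hlog0 : 0 < Real.log n := Real.log_pos (by exact_mod_cast hn)
  have hf0 : 0 ≤ ∏ u ∈ inFinset E v, rowFactor (q u) (inCount E S u) :=
    Finset.prod_nonneg fun u _ => rowFactor_nonneg ((hq u).2.trans hqh)
  refine (pow_le_pow_left₀ hf0
    (h.prod_rowFactor_le_of_small hv (by positivity) hq hqh hS) _).trans ?_
  rw [← Real.exp_nat_mul]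
  have h1 : (1 / (n : ℝ) ^ 4) ^ S.card = Real.exp (-(4 * (Real.log n * S.card))) := by
    rw [one_div, inv_pow, ← pow_mul, Real.exp_neg, ← Real.rpow_natCast,
      Real.rpow_def_of_pos hn0]
    push_cast
    ring_nf
  rw [h1, Real.exp_le_exp]
  have h2 : 7 * Real.log n / (p * n) * (S.card * ((p ^ 2 - p ^ 4 / 200) * n))
      = 7 * (Real.log n * S.card) * (p * (1 - p ^ 2 / 200)) := by
    field_simp
  rw [h2]
  have hp2 : p ^ 2 ≤ 1 := pow_le_one₀ hp0.le hp1
  -- The exponent 4 results from `(3/4) · 7 · (199/200) > 4`.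
  have h3 : 199 / 200 ≤ M * p * (1 - p ^ 2 / 200) := by nlinarith
  have h5 : 0 ≤ Real.log n * S.card := by positivity
  have h4 := mul_le_mul_of_nonneg_left h3 h5
  linarith

lemma IsRegular.undetected_le_of_large (h : IsRegular p (p ^ 4 / 200) E) (hp0 : 0 < p)
    (hp1 : p ≤ 1) (hn : 1 < n)
    (hq : ∀ u, 7 * Real.log n / (p * n) ≤ q u ∧ q u ≤ 1 / 2)
    (hS : 1 ≤ p ^ 4 / 200 * S.card) {M : ℕ} (hM : 1 + p ≤ M * p) (hM' : M * p ≤ 3) :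
    (∏ u ∈ inFinset E v, rowFactor (q u) (inCount E S u)) ^ M
      ≤ (((1 + Real.exp (-(7 * Real.log n * S.card / n))) / 2) ^ (1 + p / 2)) ^ n := by
  have hn0 : (0 : ℝ) < n := by positivity
  have hlog0 : 0 < Real.log n := Real.log_pos (by exact_mod_cast hn)
  have hf0 : 0 ≤ ∏ u ∈ inFinset E v, rowFactor (q u) (inCount E S u) :=
    Finset.prod_nonneg fun u _ => rowFactor_nonneg (hq u).2
  set c := p * (1 - p ^ 3 / 200 - 16 * p / 200) with hc
  -- Over `M ≤ 3/p` rounds, the low nodes cost a multiple of `ε / p³`. The choice `ε = p⁴ / 200`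
  -- keeps the total loss below `p / 2`.
  have hMc : 1 + p / 2 ≤ M * c := by
    have h3 : p ^ 3 ≤ p := by
      simpa using pow_le_pow_of_le_one hp0.le hp1 (show 1 ≤ 3 by norm_num)
    have h4 : M * c = M * p - M * p * (p ^ 3 / 200 + 16 * p / 200) := by rw [hc]; ring
    have h5 : M * p * (p ^ 3 / 200 + 16 * p / 200) ≤ 3 * (p / 200 + 16 * p / 200) := by gcongr
    rw [h4]; linarith
  have hcle : c ≤ p - p ^ 4 / 200 - 16 * (p ^ 4 / 200) / p ^ 2 := by
    rw [hc]; apply le_of_eq; field_simp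
  have hB := h.prod_rowFactor_le_of_large (v := v) hp0 hp1 (by positivity) hq hS hcle
  have hexp : 7 * Real.log n / (p * n) * (p * S.card) = 7 * Real.log n * S.card / n := by
    field_simp
  rw [hexp] at hB
  set ρ := (1 + Real.exp (-(7 * Real.log n * S.card / n))) / 2 with hρ
  have hρ0 : 0 < ρ := by positivity
  have hρ1 : ρ ≤ 1 := by
    have : Real.exp (-(7 * Real.log n * S.card / n)) ≤ 1 := by
      rw [Real.exp_le_one_iff, neg_nonpos]; positivity
    linarith
  refine (pow_le_pow_left₀ hf0 hB M).trans ?_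
  rw [← Real.rpow_mul_natCast hρ0.le, ← Real.rpow_mul_natCast hρ0.le]
  refine Real.rpow_le_rpow_of_exponent_ge hρ0 hρ1 ?_
  have := mul_le_mul_of_nonneg_right hMc hn0.le
  linarith

end Undetected

/-- The bound for the probability that a nonempty set is not detected in any of the
`⌈1 / p⌉ + 1` rounds. -/
lemma exists_undetected_bound {p β : ℝ} (hp0 : 0 < p) (hp1 : p ≤ 1) (hβ : 8 < β) :
    ∃ l θ ν : ℝ, 0 < l ∧ 0 < θ ∧ 0 < ν ∧ (1 + l) * θ < 1 ∧ ν < 1 ∧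
      ∀ᶠ n : ℕ in atTop, ∀ E : Graph n, IsRegular p (p ^ 4 / 200) E → ∀ (v : Fin n)
        (S : Finset (Fin n)), v ∉ S →
        (∏ u ∈ inFinset E v, rowFactor (coeffProb β (inDeg E u)) (inCount E S u)) ^ (⌈1 / p⌉₊ + 1)
          ≤ (1 / (n : ℝ) ^ 4) ^ S.card + l ^ S.card * θ ^ n + (ν / 2) ^ n := by
  set ε := p ^ 4 / 200 with hε
  have hε0 : 0 < ε := by positivity
  set M := ⌈1 / p⌉₊ + 1 with hM
  have hMp : 1 + p ≤ M * p := by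
    have h1 : 1 / p ≤ ⌈1 / p⌉₊ := Nat.le_ceil _
    rw [div_le_iff₀ hp0] at h1
    rw [hM]; push_cast; linarith
  have hMp' : M * p ≤ 3 := by
    have h1 : (⌈1 / p⌉₊ : ℝ) < 1 / p + 1 := Nat.ceil_lt_add_one (by positivity)
    have h2 : (⌈1 / p⌉₊ : ℝ) * p < (1 / p + 1) * p := mul_lt_mul_of_pos_right h1 hp0
    have h3 : (1 / p + 1) * p = 1 + p := by field_simp
    rw [hM]; push_cast; linarith
  -- Sets beyond the small range have `|S| > p n / (8 β log n)`, so `7 (log n) |S| / n` exceeds `y`.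
  set y := 7 * p / (8 * β) with hy
  have hβ0 : 0 < β := by linarith
  have hy0 : 0 < y := by positivity
  set ρ₀ := (1 + Real.exp (-y)) / 2 with hρ₀
  have hρ₀0 : 0 < ρ₀ := by positivity
  have hρ₀1 : ρ₀ < 1 := by
    have : Real.exp (-y) < 1 := by rw [← Real.exp_zero, Real.exp_lt_exp]; linarith
    linarith
  -- `ρ₀^n` is split into two factors `σ^n`: one is at most `l^|S|` while `|S| ≤ a n`, as `l^a = σ`;
  -- the other beats `(1 + l)^n`.
  set σ := √ρ₀ with hσ
  have hσ0 : 0 < σ := Real.sqrt_pos.2 hρ₀0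
  have hσ1 : σ < 1 := by
    rw [hσ, Real.sqrt_lt' one_pos]; linarith
  have hσσ : σ * σ = ρ₀ := Real.mul_self_sqrt hρ₀0.le
  set l := (1 - σ) / 2 with hl
  have hl0 : 0 < l := by linarith
  have hl1 : l < 1 := by linarith
  set a := Real.log σ / Real.log l with ha
  have hlogl : Real.log l < 0 := Real.log_neg hl0 hl1
  have ha0 : 0 < a := div_pos_of_neg_of_neg (Real.log_neg hσ0 hσ1) hlogl
  have hla : l ^ a = σ := by
    rw [Real.rpow_def_of_pos hl0, ha, mul_div_cancel₀ _ hlogl.ne, Real.exp_log hσ0]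
  -- The exponent lies strictly between 1 and `1 + p/2`: below the limiting exponent, yet enough to
  -- beat `2^n`.
  set ν : ℝ := 2 * (1 / 2) ^ (1 + p / 4) with hν
  have hν1 : ν < 1 := by
    have : (1 / 2 : ℝ) ^ (1 + p / 4) < (1 / 2) ^ (1 : ℝ) :=
      Real.rpow_lt_rpow_of_exponent_gt (by norm_num) (by norm_num) (by linarith)
    rw [Real.rpow_one] at this
    linarith
  have hlog : Tendsto (fun n : ℕ => Real.log n) atTop atTop :=
    Real.tendsto_log_atTop.comp tendsto_natCast_atTop_atTop
  have hbig : ∀ᶠ n : ℕ in atTop,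
      ((1 + Real.exp (-(7 * a * Real.log n))) / 2) ^ (1 + p / 2) ≤ ν / 2 := by
    have h1 : Tendsto (fun n : ℕ => Real.exp (-(7 * a * Real.log n))) atTop (𝓝 0) :=
      Real.tendsto_exp_neg_atTop_nhds_zero.comp (hlog.const_mul_atTop (by positivity))
    have h2 : Tendsto (fun n : ℕ => ((1 + Real.exp (-(7 * a * Real.log n))) / 2) ^ (1 + p / 2))
        atTop (𝓝 (((1 + 0) / 2) ^ (1 + p / 2))) :=
      ((h1.const_add 1).div_const 2).rpow_const (Or.inl (by norm_num))
    have h3 : ((1 + 0) / 2 : ℝ) ^ (1 + p / 2) < ν / 2 := by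
      rw [hν, mul_div_cancel_left₀ _ two_ne_zero, add_zero]
      exact Real.rpow_lt_rpow_of_exponent_gt (by norm_num) (by norm_num) (by linarith)
    filter_upwards [h2.eventually_lt_const h3] with n hn using hn.le
  refine ⟨l, σ, ν, hl0, hσ0, by positivity, by nlinarith, hν1, ?_⟩
  have hsm1 : ∀ᶠ n : ℕ in atTop, Real.log n / n < p / (4 * β) :=
    tendsto_log_div_natCast.eventually_lt_const (by positivity)
  have hsm2 : ∀ᶠ n : ℕ in atTop, Real.log n / n < ε * p / (8 * β) :=
    tendsto_log_div_natCast.eventually_lt_const (by positivity)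
  filter_upwards [eventually_ge_atTop 2, hbig, hsm1, hsm2, eventually_coeffProb_bounds hp0 hp1 hβ]
    with n hn2 hbign hsm1 hsm2 hcoeff E hE v S hv
  have hn0 : (0 : ℝ) < n := by positivity
  have hlog0 : 0 < Real.log n := Real.log_pos (by exact_mod_cast hn2)
  have hq := hcoeff E hE
  have hqh2 : 2 * β * Real.log n / (p * n) ≤ 1 / 2 := by
    rw [div_lt_div_iff₀ hn0 (by positivity)] at hsm1
    rw [div_le_div_iff₀ (by positivity) two_pos]
    linarith
  have ht1 : 0 ≤ (1 / (n : ℝ) ^ 4) ^ S.card := by positivity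
  have ht2 : 0 ≤ l ^ S.card * σ ^ n := by positivity
  have ht3 : 0 ≤ (ν / 2) ^ n := by positivity
  rcases le_or_gt (2 * β * Real.log n / (p * n) * S.card) (1 / 4) with hsmall | hlarge
  · refine (hE.undetected_le_of_small hp0 hp1 hv hn2 (hcoeff E hE) hqh2 hsmall
      (by linarith)).trans (by linarith)
  · have hkl : p * n < 8 * β * Real.log n * S.card := by
      rw [div_mul_eq_mul_div, lt_div_iff₀ (by positivity)] at hlarge
      linarith
    have hεk : 1 ≤ ε * S.card := by
      rw [div_lt_div_iff₀ hn0 (by positivity)] at hsm2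
      have h1 : Real.log n * (8 * β) * 1 ≤ Real.log n * (8 * β) * (ε * S.card) := by
        have := mul_lt_mul_of_pos_left hkl hε0
        linarith
      exact le_of_mul_le_mul_left h1 (by positivity)
    refine (hE.undetected_le_of_large hp0 hp1 hn2
      (fun u => ⟨(hcoeff E hE u).1, (hcoeff E hE u).2.trans hqh2⟩) hεk hMp hMp').trans ?_
    set ρ := (1 + Real.exp (-(7 * Real.log n * S.card / n))) / 2 with hρ
    have hρ0 : 0 < ρ := by positivity
    have hρ1 : ρ ≤ 1 := by
      have : Real.exp (-(7 * Real.log n * S.card / n)) ≤ 1 := by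
        rw [Real.exp_le_one_iff, neg_nonpos]; positivity
      linarith
    rcases le_or_gt (S.card : ℝ) (a * n) with hka | hka
    · refine le_trans ?_ (by linarith : l ^ S.card * σ ^ n ≤ _)
      have h1 : ρ ≤ ρ₀ := by
        have : y ≤ 7 * Real.log n * S.card / n := by
          rw [hy, div_le_div_iff₀ (by positivity) hn0]
          linarith
        have := Real.exp_le_exp.2 (neg_le_neg this)
        rw [hρ, hρ₀]; linarith
      have h2 : ρ ^ (1 + p / 2) ≤ σ * σ := by
        rw [hσσ]
        refine le_trans ?_ h1
        simpa using Real.rpow_le_rpow_of_exponent_ge hρ0 hρ1 (by linarith : 1 ≤ 1 + p / 2)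
      have h3 : σ ^ n ≤ l ^ S.card := by
        rw [← hla, ← Real.rpow_mul_natCast hl0.le, ← Real.rpow_natCast]
        exact Real.rpow_le_rpow_of_exponent_ge hl0 hl1.le hka
      calc (ρ ^ (1 + p / 2)) ^ n ≤ (σ * σ) ^ n := pow_le_pow_left₀ (by positivity) h2 n
        _ = σ ^ n * σ ^ n := mul_pow _ _ _
        _ ≤ _ := by gcongr
    · refine le_trans ?_ (by linarith : (ν / 2) ^ n ≤ _)
      refine pow_le_pow_left₀ (by positivity) (le_trans ?_ hbign) n
      refine Real.rpow_le_rpow hρ0.le ?_ (by linarith)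
      have : 7 * a * Real.log n ≤ 7 * Real.log n * S.card / n := by
        rw [le_div_iff₀ hn0]
        have := mul_le_mul_of_nonneg_left hka.le (by positivity : 0 ≤ 7 * Real.log n)
        linarith
      have := Real.exp_le_exp.2 (neg_le_neg this)
      rw [hρ]; linarith

/-- Summing the bound for a single set over all nonempty sets. -/
lemma sum_nonempty_le (n : ℕ) (x l θ ν : ℝ) (hl : 0 ≤ l) (hθ : 0 ≤ θ) (hν : 0 ≤ ν) :
    ∑ S : Finset (Fin n) with S.Nonempty, (x ^ S.card + l ^ S.card * θ ^ n + (ν / 2) ^ n)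
      ≤ ((1 + x) ^ n - 1) + ((1 + l) * θ) ^ n + ν ^ n := by
  classical
  have hpow : ∀ z : ℝ, ∑ S : Finset (Fin n), z ^ S.card = (1 + z) ^ n := fun z => by
    have := Finset.sum_pow_mul_eq_add_pow z 1 (Finset.univ : Finset (Fin n))
    simpa [add_comm] using this
  have hfil : (Finset.univ.filter fun S : Finset (Fin n) => S.Nonempty) = Finset.univ.erase ∅ := by
    ext S; simp [Finset.nonempty_iff_ne_empty]
  rw [hfil, Finset.sum_add_distrib, Finset.sum_add_distrib]
  refine add_le_add (add_le_add ?_ ?_) ?_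
  -- Removing the empty set matters only here: `(1 + x)^n` itself does not tend to 0.
  · have := Finset.sum_erase_eq_sub (s := Finset.univ) (f := fun S : Finset (Fin n) => x ^ S.card)
      (Finset.mem_univ ∅)
    rw [this, hpow]
    simp
  · rw [← Finset.sum_mul, mul_pow, ← hpow]
    refine mul_le_mul_of_nonneg_right ?_ (by positivity)
    exact Finset.sum_le_sum_of_subset_of_nonneg (Finset.erase_subset _ _)
      fun _ _ _ => by positivity
  · refine (Finset.sum_le_sum_of_subset_of_nonneg (Finset.erase_subset _ _)
      fun _ _ _ => by positivity).trans_eq ?_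
    simp [div_pow]
    field_simp

/-- The factor `n` counts the nodes `v`. The first bracket is `O(n⁻³)`; the others decay
geometrically. -/
lemma tendsto_union_bound {l θ ν : ℝ} (hl : 0 < l) (hθ : 0 < θ) (hν : 0 < ν)
    (h1 : (1 + l) * θ < 1) (h2 : ν < 1) :
    Tendsto (fun n : ℕ => (n : ℝ) * (((1 + 1 / (n : ℝ) ^ 4) ^ n - 1) + ((1 + l) * θ) ^ n + ν ^ n))
      atTop (𝓝 0) := by
  have e1 : Tendsto (fun n : ℕ => (n : ℝ) * ((1 + l) * θ) ^ n) atTop (𝓝 0) :=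
    tendsto_self_mul_const_pow_of_lt_one (by positivity) h1
  have e2 : Tendsto (fun n : ℕ => (n : ℝ) * ν ^ n) atTop (𝓝 0) :=
    tendsto_self_mul_const_pow_of_lt_one hν.le h2
  have e3 : Tendsto (fun n : ℕ => (n : ℝ) * ((1 + 1 / (n : ℝ) ^ 4) ^ n - 1)) atTop (𝓝 0) := by
    have h0 : Tendsto (fun n : ℕ => 2 * (1 / (n : ℝ))) atTop (𝓝 0) := by
      simpa using tendsto_one_div_atTop_nhds_zero_nat.const_mul (2 : ℝ)
    refine tendsto_of_tendsto_of_tendsto_of_le_of_le' tendsto_const_nhds h0 ?_ ?_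
    · refine Eventually.of_forall fun n => mul_nonneg (Nat.cast_nonneg n) ?_
      have : 1 ≤ (1 + 1 / (n : ℝ) ^ 4) ^ n := one_le_pow₀ (by
        have : 0 ≤ 1 / (n : ℝ) ^ 4 := by positivity
        linarith)
      linarith
    · filter_upwards [eventually_ge_atTop 1] with n hn
      have hn1 : (1 : ℝ) ≤ n := by exact_mod_cast hn
      have hn0 : (0 : ℝ) < n := by linarith
      set t : ℝ := 1 / (n : ℝ) ^ 3 with ht
      have ht0 : 0 ≤ t := by positivity
      have ht1 : t ≤ 1 := by
        rw [ht, div_le_one (by positivity)]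
        exact one_le_pow₀ hn1
      have h3 : (1 + 1 / (n : ℝ) ^ 4) ^ n ≤ Real.exp t := by
        have h4 : 1 + 1 / (n : ℝ) ^ 4 ≤ Real.exp (1 / (n : ℝ) ^ 4) := by
          linarith [Real.add_one_le_exp (1 / (n : ℝ) ^ 4)]
        refine (pow_le_pow_left₀ (by positivity) h4 n).trans_eq ?_
        rw [← Real.exp_nat_mul, ht]
        congr 1
        field_simp
      have h4 := exp_sub_one_le (t := t) (by rwa [abs_of_nonneg ht0])
      have h5 : (1 + 1 / (n : ℝ) ^ 4) ^ n - 1 ≤ 2 * t := by nlinarith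
      calc (n : ℝ) * ((1 + 1 / (n : ℝ) ^ 4) ^ n - 1) ≤ n * (2 * t) := by gcongr
        _ = 2 * (1 / (n : ℝ)) * (1 / n) := by rw [ht]; field_simp
        _ ≤ 2 * (1 / (n : ℝ)) * 1 := by
          gcongr
          rw [div_le_one hn0]
          exact hn1
        _ = _ := mul_one _
  have := (e3.add e1).add e2
  simp only [add_zero] at this
  refine this.congr fun n => ?_
  ring

end Asymptotics

/-! ### Union bound and averaging over the graph. -/

section Failure

variable {n : ℕ}

/-- The coefficients for which some nonempty set of packets that `v` did not receive in round 1 is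
orthogonal to everything that `v` received in the rounds `2, …, T`, for some node `v`. -/
def failureSet (E : Graph n) (T : ℕ) : Set (Coeffs n) :=
  ⋃ v : Fin n, ⋃ S ∈ (Finset.univ.filter fun S : Finset (Fin n) => S.Nonempty),
    {X | v ∉ S ∧ ∀ r ∈ Finset.Icc 2 T ×ˢ inFinset E v, ∑ w ∈ S, X (r.1, r.2, w) = 0}

lemma measurableSet_failureSet (E : Graph n) (T : ℕ) : MeasurableSet (failureSet E T) :=
  MeasurableSet.iUnion fun v => Finset.measurableSet_biUnion _ fun S _ =>
    (MeasurableSet.const (v ∉ S)).inter (measurableSet_orthogonal S _)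

lemma mem_failureSet_of_lt_allcastTime {L T : ℕ} (hT : 1 ≤ T) {ω : Graph n × Coeffs n}
    (h : (T : ℕ∞) < allcastTime L ω) : ω.2 ∈ failureSet ω.1 T := by
  obtain ⟨v, hv⟩ := not_canDecode_of_lt_allcastTime h
  obtain ⟨S, hS, hvS, -, hort⟩ := exists_orthogonal_of_not_canDecode hT hv
  simp only [failureSet, Set.mem_iUnion]
  refine ⟨v, S, by simpa using hS, hvS, fun r hr => ?_⟩
  rw [Finset.mem_product, mem_inFinset] at hr
  exact hort r.1 hr.1 r.2 hr.2

lemma coeffKernel_failureSet_le (β : ℝ) (E : Graph n) (T : ℕ) {B : Finset (Fin n) → ℝ}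
    (hB0 : ∀ S, 0 ≤ B S)
    (hB : ∀ v S, v ∉ S → (∏ u ∈ inFinset E v,
      rowFactor (coeffProb β (inDeg E u)) (inCount E S u)) ^ (T - 1) ≤ B S) :
    (coeffKernel n β E).real (failureSet E T)
      ≤ n * ∑ S : Finset (Fin n) with S.Nonempty, B S := by
  calc (coeffKernel n β E).real (failureSet E T)
      ≤ ∑ v : Fin n, ∑ S : Finset (Fin n) with S.Nonempty, (coeffKernel n β E).real
          {X | v ∉ S ∧ ∀ r ∈ Finset.Icc 2 T ×ˢ inFinset E v, ∑ w ∈ S, X (r.1, r.2, w) = 0} :=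
        (measureReal_iUnion_fintype_le _).trans
          (Finset.sum_le_sum fun v _ => measureReal_biUnion_finset_le _ _)
    _ ≤ ∑ v : Fin n, ∑ S : Finset (Fin n) with S.Nonempty, B S := by
        refine Finset.sum_le_sum fun v _ => Finset.sum_le_sum fun S _ => ?_
        by_cases hv : v ∈ S
        · simp [hv, hB0 S]
        · simp only [hv, not_false_eq_true, true_and]
          rw [coeffKernel_orthogonal, Finset.prod_product]
          refine Eq.trans_le ?_ (hB v S hv)
          change ∏ _t ∈ Finset.Icc 2 T, ∏ u ∈ inFinset E v,
            rowFactor (coeffProb β (inDeg E u)) (inCount E S u) = _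
          rw [Finset.prod_const, Nat.card_Icc]
          rfl
    _ = _ := by simp

/-- Conditioning on the graph: the failure probability is at most the probability that the graph
is exceptional plus the largest failure probability in a graph that is not. -/
lemma systemLaw_lt_allcastTime_le (p : unitInterval) (β : ℝ) {L T : ℕ} (hT : 1 ≤ T)
    (G : Set (Graph n)) {b : ℝ}
    (hb : ∀ E ∈ G, (coeffKernel n β E).real (failureSet E T) ≤ b) :
    systemLaw n p β {ω | (T : ℕ∞) < allcastTime L ω}
      ≤ ENNReal.ofReal ((graphLaw n p).real Gᶜ) + ENNReal.ofReal b := by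
  classical
  -- A measurable superset of the event, so measurability of the allcast time is never needed.
  let A : Set (Graph n × Coeffs n) := ⋃ E, {E} ×ˢ failureSet E T
  have hA : MeasurableSet A := MeasurableSet.iUnion fun E =>
    (measurableSet_singleton E).prod (measurableSet_failureSet E T)
  have hpre : ∀ E, Prod.mk E ⁻¹' A = failureSet E T := fun E => by
    ext X
    simp [A]
  calc systemLaw n p β {ω | (T : ℕ∞) < allcastTime L ω}
      ≤ systemLaw n p β A := by
        refine measure_mono fun ω hω => ?_
        exact Set.mem_iUnion.2 ⟨ω.1, rfl, mem_failureSet_of_lt_allcastTime hT hω⟩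
    _ = ∫⁻ E, coeffKernel n β E (failureSet E T) ∂(graphLaw n p) := by
        rw [systemLaw, Measure.compProd_apply hA]
        simp_rw [hpre]
    _ ≤ ∫⁻ E, (Gᶜ.indicator 1 E + ENNReal.ofReal b) ∂(graphLaw n p) := by
        refine lintegral_mono fun E => ?_
        by_cases hE : E ∈ G
        · refine le_add_left ?_
          rw [← ofReal_measureReal]
          exact ENNReal.ofReal_le_ofReal (hb E hE)
        · refine le_add_right ?_
          rw [Set.indicator_of_mem hE]
          exact prob_le_one
    _ = _ := by
        rw [lintegral_add_right _ measurable_const, lintegral_indicator_one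
          (Set.toFinite _).measurableSet, lintegral_const, measure_univ, mul_one,
          ofReal_measureReal]

end Failure

end RLNC

theorem theorem2 (p : unitInterval) (hp : 0 < p) (β : ℝ) (hβ : 8 < β) (L : ℕ) (hL : 1 ≤ L) :
    Tendsto
      (fun n : ℕ => RLNC.systemLaw n p β
        {ω | ((⌈1 / (p : ℝ)⌉₊ + 2 : ℕ) : ℕ∞) < RLNC.allcastTime L ω})
      atTop (𝓝 0) := by
  have hp0 : (0 : ℝ) < p := hp
  have hp1 : (p : ℝ) ≤ 1 := p.2.2
  obtain ⟨l, θ, ν, hl, hθ, hν, h1, h2, hev⟩ := RLNC.exists_undetected_bound hp0 hp1 hβ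
  have hε1 : (p : ℝ) ^ 4 / 200 ≤ 1 := by linarith [pow_le_one₀ hp0.le hp1 (n := 4)]
  have hlim := (ENNReal.tendsto_ofReal
    (RLNC.tendsto_graphLaw_not_isRegular p (by positivity) hε1)).add
    (ENNReal.tendsto_ofReal (RLNC.tendsto_union_bound hl hθ hν h1 h2))
  simp only [ENNReal.ofReal_zero, add_zero] at hlim
  refine tendsto_of_tendsto_of_tendsto_of_le_of_le' tendsto_const_nhds hlim
    (Eventually.of_forall fun _ => zero_le) ?_
  filter_upwards [hev] with n hn
  -- With `T = ⌈1/p⌉ + 2`, rounds `2, …, T` are exactly the `⌈1/p⌉ + 1` coded rounds of the bound.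
  refine RLNC.systemLaw_lt_allcastTime_le p β (by omega)
    {E | RLNC.IsRegular p ((p : ℝ) ^ 4 / 200) E} fun E hE => ?_
  refine (RLNC.coeffKernel_failureSet_le β E _ (fun S => by positivity)
    fun v S hv => hn E hE v S hv).trans ?_
  exact mul_le_mul_of_nonneg_left (RLNC.sum_nonempty_le n _ l θ ν hl.le hθ.le hν.le)
    (Nat.cast_nonneg n)
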